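/- Let $G=(V,E)$ be any undirected graph on $V=[N]$. For $i\in V$ put $\mathcal N_i=\{i\}\cup\{j:(i,j)\in E\}$ and $N_i=|\mathcal N_i|$. Let $w_{ij}\ge 0$ be weights with $\sum_{j\in\mathcal N_i}w_{ij}=1$ for every $i$, and put $L_j=\max_{i\in\mathcal N_j}w_{ij}$. Let $i_1,i_2,\dots\in V$ be an arbitrary sequence of active agents and $\ell_1,\ell_2,\dots:\mathbb R^d\to\mathbb R$ convex losses. *MT-COOL.* At time $t$ the active agent predicts $x_t=\sum_{j\in\mathcal N_{i_t}}w_{i_tj}[Y^{(j)}_t]_{i_t:}$, incurs $\ell_t(x_t)$, observes $g_t\in\partial\ell_t(x_t)$, where $\|g_t\|_2\le 1$, and feeds the linear loss $\langle w_{i_tj}g_t,\cdot\rangle$ on row $i_t$ to the base algorithm of each $j\in\mathcal N_{i_t}$. Here $Y^{(j)}_t\in\mathbb R^{N_j\times d}$ (rows indexed by $\mathcal N_j$) is the current output of the base algorithm of agent $j$. *Base algorithm of agent $j$ (MT-FTRL with Krichevsky–Trofimov magnitude).* Let $A_j=(1+N_j)I-\mathbf 1\mathbf 1^\top\in\mathbb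 R^{N_j\times N_j}$ and $\|X\|_{A_j}^2=\operatorname{tr}(X^\top A_jX)$. In its $\tau$-th local round ($\tau-1$ being the number of earlier times with an active agent in $\mathcal N_j$), let $G_s\in\mathbb R^{N_j\times d}$ be the gradient matrix of local round $s<\tau$ (the only nonzero row is that of the agent active in that round; it is the gradient fed). Agent $j$ computes, with $\beta_{\tau-1}=L_j\sqrt{\tau}$, $$\widetilde Y_\tau=\operatorname*{argmin}_{\|X\|_{A_j}\le1}\ \frac{\sqrt{N_j}}{\beta_{\tau-1}}\Big\langle\sum_{s<\tau}G_s,X\Big\rangle+\frac12\|X\|_{A_j}^2,\qquad z_\tau=-\frac1\tau\Big(\sum_{s<\tau}u_s\Big)\Big(1-\sum_{s<\tau}z_su_s\Big),$$ outputs $z_\tau\widetilde Y_\tau$, and after receiving the gradient matrix $G_\tau$ sets $u_\tau=\frac{\sqrt{N_j}}{\sqrt2\,L_j}\langle\widetilde Y_\tau,G_\tau\rangle$. (If $L_j=0$, the outputs of agent $j$ have weight $0$; then $1/L_j$ and $1/\beta_{\tau-1}$ are read as $0$.) For $U\in\mathbb R^{N\times d}$ let $\sigma_j^2=\frac1{2N_j(N_j-1)}\sum_{i,i'\in\mathcal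 N_j}\|U_{i:}-U_{i':}\|_2^2$ (read as $0$ if $N_j=1$), let $T_i=|\{t\le T:i_t=i\}|$, and let $R_T(U)=\sum_{t=1}^T\big(\ell_t(x_t)-\ell_t(U_{i_t:})\big)$. **Theorem.** For every horizon $T$ and every $U$ all of whose rows satisfy $\|U_{i:}\|_2\le1$, $$R_T(U)=\widetilde{\mathcal O}\Big(\sum_{j=1}^N\sqrt{1+\sigma_j^2(N_j-1)}\,\sqrt{\sum_{i\in\mathcal N_j}T_i}\Big),$$ where $\widetilde{\mathcal O}$ hides factors in $\log N$ and $\log T$. That is, there are universal constants $C>0$ and $k\in\mathbb N$ (independent of $N,d,T,G$, the weights, the activations, the losses, the gradients and $U$) such that, with $\log 0$ read as $0$, $$R_T(U)\le C\big((1+\ln N)(1+\ln T)\big)^k\sum_{j=1}^N\sqrt{1+\sigma_j^2(N_j-1)}\,\sqrt{\sum_{i\in\mathcal N_j}T_i}.$$ -/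

import Mathlib

noncomputable section

namespace MTCool

/-! ## The base algorithm: `MT-FTRL` with the Krichevsky–Trofimov magnitude, on a clique -/

/-- The space of a single model, `ℝ^d` with its Euclidean norm. -/
abbrev Model (d : ℕ) : Type := EuclideanSpace ℝ (Fin d)

/-- A multitask model: a real matrix with one row in `ℝ^d` for each agent in `ι`. -/
abbrev MultiModel (ι : Type) (d : ℕ) : Type := ι → Model d

/-- What a clique algorithm has received so far, *most recent round first*. An entry `(i, h)` records
a round in which agent `i` was active and the linear loss `⟨h, ·⟩` of row `i` was fed. -/
abbrev History (ι : Type) (d : ℕ) : Type := List (ι × Model d)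

/-- A multitask algorithm on the clique with vertex set `ι`: it maps the past rounds to the next
matrix of predictions. -/
abbrev CliqueAlgorithm (ι : Type) (d : ℕ) : Type := History ι d → MultiModel ι d

section Base

variable {ι : Type} [Fintype ι] [DecidableEq ι] {d : ℕ}

/-- The matrix `A = (1 + N) I_N - 1 1ᵀ`, where `N` is the number of agents in `ι`. -/
def interactionMatrix (ι : Type) [Fintype ι] [DecidableEq ι] : Matrix ι ι ℝ :=
  (1 + (Fintype.card ι : ℝ)) • (1 : Matrix ι ι ℝ) - Matrix.of (fun _ _ => (1 : ℝ))

/-- `‖X‖_A ^ 2 = tr (Xᵀ A X) = ∑ i i', A i i' ⟨X i, X i'⟩`. -/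
def normSqA (X : MultiModel ι d) : ℝ :=
  ∑ i, ∑ i', interactionMatrix ι i i' * inner ℝ (X i) (X i')

/-- The Mahalanobis norm `‖X‖_A`. -/
def normA (X : MultiModel ι d) : ℝ := Real.sqrt (normSqA X)

/-- The sum of the gradient matrices `G_s = e_{i_s} h_sᵀ` over the past rounds. -/
def gradSum : History ι d → MultiModel ι d
  | [] => 0
  | (i, h) :: past => gradSum past + Pi.single i h

/-- The objective `(√N / β) ⟨∑ G_s, X⟩ + ‖X‖_A ^ 2 / 2` of the direction update. -/
def ftrlObjective (b : ℝ) (H : History ι d) (X : MultiModel ι d) : ℝ :=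
  Real.sqrt (Fintype.card ι) / b * (∑ i, inner ℝ (gradSum H i) (X i)) + 1 / 2 * normA X ^ 2

/-- `X` minimises the objective of the direction update over the unit ball of `‖·‖_A`. -/
def IsDirection (b : ℝ) (H : History ι d) (X : MultiModel ι d) : Prop :=
  normA X ≤ 1 ∧ IsMinOn (ftrlObjective b H) {Z | normA Z ≤ 1} X

theorem normSqA_eq (X : MultiModel ι d) :
    normSqA X = (1 + (Fintype.card ι : ℝ)) * ∑ i, ‖X i‖ ^ 2 - ‖∑ i, X i‖ ^ 2 := by
  have h2 : ‖∑ i, X i‖ ^ 2 = ∑ i, ∑ i', inner ℝ (X i) (X i') := by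
    rw [← real_inner_self_eq_norm_sq, sum_inner]
    simp_rw [inner_sum]
  rw [h2, Finset.mul_sum, ← Finset.sum_sub_distrib]
  unfold normSqA interactionMatrix
  refine Finset.sum_congr rfl fun i _ => ?_
  simp [Matrix.one_apply, sub_mul, Finset.sum_sub_distrib]

theorem sum_norm_sq_le_normSqA (X : MultiModel ι d) : ∑ i, ‖X i‖ ^ 2 ≤ normSqA X := by
  have h1 : ‖∑ i, X i‖ ^ 2 ≤ (Fintype.card ι : ℝ) * ∑ i, ‖X i‖ ^ 2 := by
    calc ‖∑ i, X i‖ ^ 2 ≤ (∑ i, ‖X i‖) ^ 2 := by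
          gcongr
          exact norm_sum_le _ _
      _ ≤ (Fintype.card ι : ℝ) * ∑ i, ‖X i‖ ^ 2 := sq_sum_le_card_mul_sum_sq
  rw [normSqA_eq]
  linarith

theorem continuous_normA : Continuous (normA : MultiModel ι d → ℝ) := by
  unfold normA normSqA
  fun_prop

/-- The minimum in the direction update is attained. (The minimiser is unique, since the objective
is strictly convex.) -/
theorem exists_isDirection (b : ℝ) (H : History ι d) :
    ∃ X : MultiModel ι d, IsDirection b H X := by
  have hcl : IsClosed {Z : MultiModel ι d | normA Z ≤ 1} :=
    isClosed_le continuous_normA continuous_const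
  have hsub : {Z : MultiModel ι d | normA Z ≤ 1} ⊆ Metric.closedBall 0 1 := by
    intro Z hZ
    have hZ' : normSqA Z ≤ 1 := by
      have h := hZ
      simp only [Set.mem_ofPred_eq, normA, Real.sqrt_le_one] at h
      simpa using h
    rw [mem_closedBall_zero_iff, pi_norm_le_iff_of_nonneg zero_le_one]
    intro i
    have h1 : ‖Z i‖ ^ 2 ≤ ∑ i, ‖Z i‖ ^ 2 :=
      Finset.single_le_sum (f := fun i => ‖Z i‖ ^ 2) (fun _ _ => by positivity) (Finset.mem_univ i)
    have h2 := sum_norm_sq_le_normSqA Z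
    exact (sq_le_one_iff₀ (norm_nonneg _)).1 (by linarith)
  have hcomp : IsCompact {Z : MultiModel ι d | normA Z ≤ 1} :=
    (isCompact_closedBall 0 1).of_isClosed_subset hcl hsub
  have hcont : Continuous (ftrlObjective b H : MultiModel ι d → ℝ) := by
    have := continuous_normA (ι := ι) (d := d)
    unfold ftrlObjective
    fun_prop
  obtain ⟨X, hX, hmin⟩ := hcomp.exists_isMinOn ⟨0, by simp [normA, normSqA]⟩ hcont.continuousOn
  exact ⟨X, hX, hmin⟩

/-- The direction `Ỹ = argmin_{‖X‖_A ≤ 1} (√N / β) ⟨∑ G_s, X⟩ + ‖X‖_A ^ 2 / 2`. -/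
def direction (b : ℝ) (H : History ι d) : MultiModel ι d := (exists_isDirection b H).choose

theorem direction_spec (b : ℝ) (H : History ι d) : IsDirection b H (direction b H) :=
  (exists_isDirection b H).choose_spec

/-- `u = √N / (√2 L) ⟨[Ỹ]_i, h⟩`, the one-dimensional loss slope generated by the round `(i, h)`
that follows the rounds in `past`. The learning rate at a round with `n` predecessors is `β n`. -/
def ktSlope (β : ℕ → ℝ) (L : ℝ) (past : History ι d) (i : ι) (h : Model d) : ℝ :=
  Real.sqrt (Fintype.card ι) / (Real.sqrt 2 * L) * inner ℝ (direction (β past.length) past i) h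

/-- `∑ u_s` over the past rounds. -/
def ktSlopeSum (β : ℕ → ℝ) (L : ℝ) : History ι d → ℝ
  | [] => 0
  | (i, h) :: past => ktSlopeSum β L past + ktSlope β L past i h

/-- `∑ z_s u_s` over the past rounds, where
`z_t = -(1 / t) (∑_{s < t} u_s) (1 - ∑_{s < t} z_s u_s)`. -/
def ktLossSum (β : ℕ → ℝ) (L : ℝ) : History ι d → ℝ
  | [] => 0
  | (i, h) :: past =>
      ktLossSum β L past +
        (-(1 / ((past.length : ℝ) + 1)) * ktSlopeSum β L past * (1 - ktLossSum β L past)) *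
          ktSlope β L past i h

/-- The Krichevsky–Trofimov magnitude
`z_t = -(1 / t) (∑_{s < t} u_s) (1 - ∑_{s < t} z_s u_s)`, where `t - 1` is the number of past
rounds. -/
def ktMagnitude (β : ℕ → ℝ) (L : ℝ) (H : History ι d) : ℝ :=
  -(1 / ((H.length : ℝ) + 1)) * ktSlopeSum β L H * (1 - ktLossSum β L H)

/-- `MT-FTRL` with the KT adaptive magnitude: predict `Y_t = z_t Ỹ_t`. Here `β n` is the
learning-rate parameter `β_{t-1}` of the round `t = n + 1`, and `L` is the bound on the norms of the
gradients. -/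
def mtftrlKT (β : ℕ → ℝ) (L : ℝ) : CliqueAlgorithm ι d :=
  fun H => ktMagnitude β L H • direction (β H.length) H

end Base

/-! ## The meta-algorithm `MT-COOL` on a communication graph -/

section Cool

variable {N : ℕ} (G : SimpleGraph (Fin N)) [DecidableRel G.Adj] {d : ℕ}

/-- `𝒩_i = {i} ∪ {j : (i, j) ∈ E}`. -/
def nbhd (i : Fin N) : Finset (Fin N) := insert i (G.neighborFinset i)

theorem mem_nbhd_self (i : Fin N) : i ∈ nbhd G i := Finset.mem_insert_self _ _

theorem mem_nbhd_symm {i j : Fin N} (h : j ∈ nbhd G i) : i ∈ nbhd G j := by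
  simp only [nbhd, Finset.mem_insert, SimpleGraph.mem_neighborFinset] at h ⊢
  exact h.imp Eq.symm SimpleGraph.Adj.symm

/-- The rounds fed to the local instance of agent `j` before (global, zero-based) time `t`: those
with an active agent `i_s ∈ 𝒩_j`, each with the linear loss `⟨w_{i_s j} g_s, ·⟩`. -/
def localHistory (w : Fin N → Fin N → ℝ) (act : ℕ → Fin N) (g : ℕ → Model d) (j : Fin N) :
    ℕ → History (nbhd G j) d
  | 0 => []
  | t + 1 =>
      if h : act t ∈ nbhd G j then
        (⟨act t, h⟩, w (act t) j • g t) :: localHistory w act g j t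
      else localHistory w act g j t

/-- The prediction `x_t = ∑_{j ∈ 𝒩_{i_t}} w_{i_t j} [Y_t^{(j)}]_{i_t}` of `MT-COOL`, where agent `j`
runs the clique algorithm `base j` on the virtual clique `𝒩_j`. It depends on the gradients
`g s` with `s < t` only. -/
def coolPrediction (base : (j : Fin N) → CliqueAlgorithm (nbhd G j) d)
    (w : Fin N → Fin N → ℝ) (act : ℕ → Fin N) (g : ℕ → Model d) (t : ℕ) : Model d :=
  ∑ j : nbhd G (act t),
    w (act t) j • base j (localHistory G w act g j t) ⟨act t, mem_nbhd_symm G j.2⟩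

/-- `max_{i ∈ 𝒩_j} w_{ij}`. -/
def maxWeight (w : Fin N → Fin N → ℝ) (j : Fin N) : ℝ :=
  (nbhd G j).sup' ⟨j, mem_nbhd_self G j⟩ (fun i => w i j)

/-- The base algorithm of agent `j`: `MT-FTRL` with the KT magnitude on `𝒩_j`, with
`L = max_{i ∈ 𝒩_j} w_{ij}` and, after `n` rounds with an active agent in `𝒩_j`, learning-rate
parameter `max_{i ∈ 𝒩_j} w_{ij} √(1 + n)`. -/
def baseKT (w : Fin N → Fin N → ℝ) (j : Fin N) : CliqueAlgorithm (nbhd G j) d :=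
  mtftrlKT (fun n => maxWeight G w j * Real.sqrt (1 + (n : ℝ))) (maxWeight G w j)

/-- The predictions of `MT-COOL` with the base algorithm `baseKT`. -/
def coolKT (w : Fin N → Fin N → ℝ) (act : ℕ → Fin N) (g : ℕ → Model d) (t : ℕ) : Model d :=
  coolPrediction G (baseKT G w) w act g t

/-- `v ∈ ∂f(x)`. -/
def IsSubgradient (f : Model d → ℝ) (x v : Model d) : Prop :=
  ∀ y, f x + inner ℝ v (y - x) ≤ f y

/-- The multitask regret `R_T(U) = ∑_{t ≤ T} (ℓ_t(x_t) - ℓ_t(U_{i_t}))` of the predictions `x`. -/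
def regret (ℓ : ℕ → Model d → ℝ) (act : ℕ → Fin N) (x : ℕ → Model d)
    (U : MultiModel (Fin N) d) (T : ℕ) : ℝ :=
  ∑ t ∈ Finset.range T, (ℓ t (x t) - ℓ t (U (act t)))

/-- `T_i`, the number of rounds among the first `T` in which agent `i` is active. -/
def activations (act : ℕ → Fin N) (T : ℕ) (i : Fin N) : ℕ :=
  ((Finset.range T).filter (fun t => act t = i)).card

/-- The local task variance
`σ_j^2 = 1 / (2 N_j (N_j - 1)) ∑_{i, i' ∈ 𝒩_j} ‖U_i - U_{i'}‖ ^ 2` (which is `0` if `N_j = 1`). -/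
def localVariance (U : MultiModel (Fin N) d) (j : Fin N) : ℝ :=
  1 / (2 * ((nbhd G j).card : ℝ) * (((nbhd G j).card : ℝ) - 1)) *
    ∑ i ∈ nbhd G j, ∑ i' ∈ nbhd G j, ‖U i - U i'‖ ^ 2

end Cool

end MTCool

end

/-! By the subgradient inequality the regret is at most the sum of `⟨g_t, x_t - U_{i_t}⟩`. The
weights of the active agent sum to one, so this sum splits exactly into the regrets of the base
algorithms, each on its own history and against the rows of `U` in its neighbourhood
(`regret_le_sum_localTerm`, `sum_localTerm`).

On a clique of `n` agents write `U = ρ V` with `ρ = ‖U‖_A` and `‖V‖_A ≤ 1`. The regret is that of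
the magnitudes `z` against `ρ`, plus `ρ` times that of the directions against `V`. The directions
are FTRL: as `A⁻¹ = (I + 11ᵀ)/(n + 1)` has diagonal `2/(n + 1)`, a one-row gradient has dual norm of
order `L/√n`, and `m` rounds cost of order `L √(m/n)` (`cumLoss_direction_le`). The magnitudes are
coin betting: the wealth dominates the KT potential (`ktPotential_le_wealth`), which is at least of
order `exp(x²/(2m))/(m + 1)` (`exp_le_ktPotential`), so competing with `ρ` costs `ρ √m` up to
logarithms.

The total is `L (1 + ρ √m)/√n` up to logarithms. Since `A` is the identity plus the Laplacian of the
complete graph, `ρ ≤ √n √(1 + σ²(n - 1))`; the factor `√n` cancels, and `L ≤ 1`. -/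

noncomputable section

namespace MTCool

/-! ### The Krichevsky–Trofimov potential and its growth. -/

section Potential

/-- The Krichevsky–Trofimov coin-betting potential. -/
def ktPotential (t : ℕ) (x : ℝ) : ℝ :=
  2 ^ t * (Real.Gamma ((t + 1 + x) / 2) * Real.Gamma ((t + 1 - x) / 2)) / (Real.pi * t.factorial)

theorem ktPotential_zero : ktPotential 0 0 = 1 := by
  have h := Real.Gamma_one_half_eq
  simp only [ktPotential, pow_zero, Nat.cast_zero, zero_add, add_zero, sub_zero, one_mul,
    Nat.factorial_zero, Nat.cast_one, mul_one, h]
  rw [Real.mul_self_sqrt Real.pi_pos.le, div_self Real.pi_pos.ne']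

theorem ktPotential_neg (t : ℕ) (x : ℝ) : ktPotential t (-x) = ktPotential t x := by
  simp only [ktPotential, sub_neg_eq_add, ← sub_eq_add_neg]
  ring

theorem ktPotential_pos {t : ℕ} {x : ℝ} (h : |x| < t + 1) : 0 < ktPotential t x := by
  obtain ⟨h1, h2⟩ := abs_lt.1 h
  have := Real.Gamma_pos_of_pos (s := (t + 1 + x) / 2) (by linarith)
  have := Real.Gamma_pos_of_pos (s := (t + 1 - x) / 2) (by linarith)
  have := Real.pi_pos
  unfold ktPotential
  positivity

theorem ktPotential_succ_add_one (t : ℕ) {x : ℝ} (h : |x| < t + 1) :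
    ktPotential (t + 1) (x + 1) = ktPotential t x * (1 + x / (t + 1)) := by
  obtain ⟨h1, h2⟩ := abs_lt.1 h
  have hp := Real.pi_pos
  have hf : (0 : ℝ) < t.factorial := by positivity
  have e1 : ((t + 1 : ℕ) + 1 + (x + 1) : ℝ) / 2 = (t + 1 + x) / 2 + 1 := by push_cast; ring
  have e2 : ((t + 1 : ℕ) + 1 - (x + 1) : ℝ) / 2 = (t + 1 - x) / 2 := by push_cast; ring
  unfold ktPotential
  rw [e1, e2, Real.Gamma_add_one (by linarith), Nat.factorial_succ]
  push_cast
  field_simp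
  ring

theorem ktPotential_succ_sub_one (t : ℕ) {x : ℝ} (h : |x| < t + 1) :
    ktPotential (t + 1) (x - 1) = ktPotential t x * (1 - x / (t + 1)) := by
  have := ktPotential_succ_add_one t (x := -x) (by rwa [abs_neg])
  rw [ktPotential_neg, show -x + 1 = -(x - 1) by ring, ktPotential_neg] at this
  rw [this]
  ring

/-- Up to a constant, the logarithm is a sum of two copies of the convex `log Γ` composed with
affine maps. -/
theorem convexOn_log_ktPotential (t : ℕ) :
    ConvexOn ℝ (Set.Ioo (-((t : ℝ) + 1)) (t + 1)) fun x => Real.log (ktPotential t x) := by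
  have hG := Real.convexOn_log_Gamma
  refine ⟨convex_Ioo _ _, fun x hx y hy a b ha hb hab => ?_⟩
  obtain ⟨hx1, hx2⟩ := hx
  obtain ⟨hy1, hy2⟩ := hy
  have key : ∀ z : ℝ, -((t : ℝ) + 1) < z → z < t + 1 → Real.log (ktPotential t z) =
      Real.log (Real.Gamma ((t + 1 + z) / 2)) + Real.log (Real.Gamma ((t + 1 - z) / 2)) +
        (Real.log (2 ^ t) - Real.log (Real.pi * t.factorial)) := by
    intro z h1 h2
    have g1 := Real.Gamma_pos_of_pos (s := (t + 1 + z) / 2) (by linarith)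
    have g2 := Real.Gamma_pos_of_pos (s := (t + 1 - z) / 2) (by linarith)
    have := Real.pi_pos
    unfold ktPotential
    rw [Real.log_div (by positivity) (by positivity), Real.log_mul (by positivity) (by positivity),
      Real.log_mul g1.ne' g2.ne']
    ring
  have hz := (convex_Ioo (-((t : ℝ) + 1)) (t + 1)) ⟨hx1, hx2⟩ ⟨hy1, hy2⟩ ha hb hab
  have c1 := hG.2 (x := (t + 1 + x) / 2) (Set.mem_Ioi.2 (by linarith))
    (y := (t + 1 + y) / 2) (Set.mem_Ioi.2 (by linarith)) ha hb hab
  have c2 := hG.2 (x := (t + 1 - x) / 2) (Set.mem_Ioi.2 (by linarith))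
    (y := (t + 1 - y) / 2) (Set.mem_Ioi.2 (by linarith)) ha hb hab
  simp only [smul_eq_mul, Function.comp] at c1 c2 hz ⊢
  obtain rfl : b = 1 - a := by linarith
  rw [show a * ((t + 1 + x) / 2) + (1 - a) * ((t + 1 + y) / 2)
    = (t + 1 + (a * x + (1 - a) * y)) / 2 by ring] at c1
  rw [show a * ((t + 1 - x) / 2) + (1 - a) * ((t + 1 - y) / 2)
    = (t + 1 - (a * x + (1 - a) * y)) / 2 by ring] at c2
  rw [key _ hz.1 hz.2, key x hx1 hx2, key y hy1 hy2]
  linarith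

theorem convexOn_ktPotential (t : ℕ) :
    ConvexOn ℝ (Set.Ioo (-((t : ℝ) + 1)) (t + 1)) (ktPotential t) := by
  refine ⟨convex_Ioo _ _, fun x hx y hy a b ha hb hab => ?_⟩
  have hz := (convex_Ioo (-((t : ℝ) + 1)) (t + 1)) hx hy ha hb hab
  have h1 := (convexOn_log_ktPotential t).2 hx hy ha hb hab
  have h2 := convexOn_exp.2 (Set.mem_univ (Real.log (ktPotential t x)))
    (Set.mem_univ (Real.log (ktPotential t y))) ha hb hab
  rw [Real.exp_log (ktPotential_pos (abs_lt.2 hx)), Real.exp_log (ktPotential_pos (abs_lt.2 hy))]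
    at h2
  refine le_trans ?_ h2
  rw [← Real.exp_log (ktPotential_pos (abs_lt.2 hz))]
  exact Real.exp_le_exp.2 h1

/-- The point `x + c` is the mean of `x + 1` and `x - 1` with weights `(1 ± c)/2`, so convexity
reduces to the exact recurrences for coins `±1`. This is one round of betting the fraction `x/(t +
1)` on the coin `c`. -/
theorem ktPotential_succ_le (t : ℕ) {x c : ℝ} (hx : |x| ≤ t) (hc : |c| ≤ 1) :
    ktPotential (t + 1) (x + c) ≤ ktPotential t x * (1 + c * (x / (t + 1))) := by
  obtain ⟨h1, h2⟩ := abs_le.1 hx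
  obtain ⟨h3, h4⟩ := abs_le.1 hc
  have hlt : |x| < t + 1 := by linarith
  have h := (convexOn_ktPotential (t + 1)).2 (x := x + 1) (y := x - 1)
    ⟨by push_cast; linarith, by push_cast; linarith⟩
    ⟨by push_cast; linarith, by push_cast; linarith⟩
    (by linarith : 0 ≤ (1 + c) / 2) (by linarith : 0 ≤ (1 - c) / 2) (by ring)
  simp only [smul_eq_mul] at h
  rw [ktPotential_succ_add_one t hlt, ktPotential_succ_sub_one t hlt,
    show (1 + c) / 2 * (x + 1) + (1 - c) / 2 * (x - 1) = x + c by ring] at h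
  linarith

theorem ktPotential_zero_le (t : ℕ) {x : ℝ} (hx : |x| < t + 1) :
    ktPotential t 0 ≤ ktPotential t x := by
  obtain ⟨h1, h2⟩ := abs_lt.1 hx
  have h := (convexOn_ktPotential t).2 (x := x) (y := -x) ⟨h1, h2⟩ ⟨by linarith, by linarith⟩
    (by norm_num : (0 : ℝ) ≤ 1 / 2) (by norm_num : (0 : ℝ) ≤ 1 / 2) (by norm_num)
  simp only [smul_eq_mul, ktPotential_neg] at h
  rw [show 1 / 2 * x + 1 / 2 * -x = 0 by ring] at h
  linarith

/-- Moving up to `1` and back to `0` multiplies the potential by `1 - 1/(t + 2)`, hence an induction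
in steps of two. -/
theorem inv_le_ktPotential_at_zero : ∀ t : ℕ, 1 / ((t : ℝ) + 1) ≤ ktPotential t 0
  | 0 => by rw [ktPotential_zero]; norm_num
  | 1 => by
      have : (1 : ℝ) / (1 + 1) ≤ 2 / Real.pi := by
        rw [div_le_div_iff₀ (by norm_num) Real.pi_pos]
        linarith [Real.pi_le_four]
      simpa [ktPotential, Real.Gamma_one] using this
  | t + 2 => by
      have ih := inv_le_ktPotential_at_zero t
      have h1 := ktPotential_succ_sub_one (t + 1) (x := 1) (by
        push_cast; rw [abs_one]; linarith [t.cast_nonneg (α := ℝ)])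
      have h2 := ktPotential_succ_add_one t (x := 0) (by rw [abs_zero]; positivity)
      rw [zero_add] at h2
      rw [sub_self, h2] at h1
      rw [h1]
      push_cast
      have ht : (0 : ℝ) ≤ t := t.cast_nonneg
      calc 1 / ((t : ℝ) + 2 + 1) ≤ 1 / ((t : ℝ) + 1) * (1 - 1 / (t + 1 + 1)) := by
            rw [show 1 / ((t : ℝ) + 1) * (1 - 1 / (t + 1 + 1)) = 1 / (t + 2) by field_simp; ring]
            exact one_div_le_one_div_of_le (by linarith) (by linarith)
        _ ≤ _ := by
            rw [zero_div, add_zero, mul_one]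
            refine mul_le_mul_of_nonneg_right ih (sub_nonneg.2 ?_)
            rw [div_le_one (by linarith)]
            linarith

/-- Two-step growth of the potential away from the origin. -/
theorem exp_mul_ktPotential_le (t : ℕ) {x : ℝ} (h0 : 0 ≤ x) (hx : x < t + 1) :
    Real.exp (2 * x / (t + 1)) * ktPotential (t + 1) (x - 1) ≤ ktPotential (t + 1) (x + 1) := by
  have hlt : |x| < t + 1 := by rwa [abs_of_nonneg h0]
  rw [ktPotential_succ_add_one t hlt, ktPotential_succ_sub_one t hlt]
  have hF := ktPotential_pos hlt
  have hy0 : 0 ≤ x / (t + 1) := by positivity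
  have hy1 : x / (t + 1) < 1 := by rwa [div_lt_one (by positivity)]
  rw [mul_div_assoc]
  set y := x / ((t : ℝ) + 1)
  -- The first term of the series of `artanh y` gives `2y ≤ log((1 + y)/(1 - y))`.
  have key : Real.exp (2 * y) * (1 - y) ≤ 1 + y := by
    have hl := Real.sum_range_le_log_div hy0 hy1 1
    simp at hl
    have : 2 * y ≤ Real.log ((1 + y) / (1 - y)) := by linarith
    have := Real.exp_le_exp.2 this
    rw [Real.exp_log (div_pos (by linarith) (by linarith)), le_div_iff₀ (by linarith)] at this
    exact this
  calc _ = ktPotential t x * (Real.exp (2 * y) * (1 - y)) := by ring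
    _ ≤ _ := by gcongr

/-- Passing from `x - 2` to `x` gains a factor `exp(2(x - 1)/(t + 1))`, exactly the increment of
`x²/(2(t + 1))` in the exponent. The offset `-1/2` makes the bound at most `1/(t + 2)` when `|x| ≤
1`, which starts the descent; `k` only serves as the induction variable. -/
theorem exp_le_ktPotential (t : ℕ) : ∀ (k : ℕ) (x : ℝ), 0 ≤ x → x ≤ k → x ≤ t + 1 →
    Real.exp (x ^ 2 / (2 * (t + 1)) - 1 / 2) / (t + 2) ≤ ktPotential (t + 1) x := by
  have hsmall : ∀ x : ℝ, |x| ≤ 1 →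
      Real.exp (x ^ 2 / (2 * (t + 1)) - 1 / 2) / (t + 2) ≤ ktPotential (t + 1) x := by
    intro x hx
    have h1 := inv_le_ktPotential_at_zero (t + 1)
    have h2 := ktPotential_zero_le (t + 1) (x := x) (by
      push_cast; linarith [t.cast_nonneg (α := ℝ)])
    refine le_trans ?_ (h1.trans h2)
    push_cast
    rw [add_assoc, one_add_one_eq_two]
    gcongr
    rw [Real.exp_le_one_iff, sub_nonpos, div_le_div_iff₀ (by positivity) (by norm_num)]
    have : x ^ 2 ≤ 1 := (sq_le_one_iff_abs_le_one x).2 hx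
    linarith [t.cast_nonneg (α := ℝ)]
  intro k
  induction k using Nat.strong_induction_on with
  | _ k ih =>
    intro x h0 hk hx
    rcases le_or_gt x 1 with h | h
    · exact hsmall x (by rwa [abs_of_nonneg h0])
    have ht : (0 : ℝ) ≤ t := t.cast_nonneg
    have hk0 : k ≠ 0 := by rintro rfl; push_cast at hk; linarith
    have hprev : Real.exp ((x - 2) ^ 2 / (2 * (t + 1)) - 1 / 2) / (t + 2) ≤
        ktPotential (t + 1) (x - 2) := by
      rcases le_or_gt x 2 with h' | h'
      · exact hsmall _ (by rw [abs_le]; constructor <;> linarith)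
      · refine ih (k - 1) (by omega) (x - 2) (by linarith) ?_ (by linarith)
        rw [Nat.cast_sub (by omega)]
        push_cast
        linarith
    have hstep := exp_mul_ktPotential_le t (x := x - 1) (by linarith) (by linarith)
    rw [show x - 1 - 1 = x - 2 by ring, sub_add_cancel] at hstep
    refine le_trans (le_of_eq ?_) ((mul_le_mul_of_nonneg_left hprev (Real.exp_pos _).le).trans hstep)
    rw [← mul_div_assoc, ← Real.exp_add]
    congr 2
    field_simp
    ring

end Potential

/-! ### Geometry of the `A`-norm and FTRL regret of the directions. -/

section Base
variable {ι : Type} [Fintype ι] {d : ℕ}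

/-- The Frobenius pairing of two multitask models. -/
def pairing (X Y : MultiModel ι d) : ℝ := ∑ i, inner ℝ (X i) (Y i)

theorem pairing_smul_right (a : ℝ) (X Y : MultiModel ι d) :
    pairing X (a • Y) = a * pairing X Y := by
  simp [pairing, inner_smul_right, Finset.mul_sum]

variable [DecidableEq ι]

theorem normSqA_nonneg (X : MultiModel ι d) : 0 ≤ normSqA X :=
  le_trans (Finset.sum_nonneg fun _ _ => by positivity) (sum_norm_sq_le_normSqA X)

theorem normA_sq (X : MultiModel ι d) : normA X ^ 2 = normSqA X := Real.sq_sqrt (normSqA_nonneg X)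

theorem normA_le_one_iff (X : MultiModel ι d) : normA X ≤ 1 ↔ normSqA X ≤ 1 := by
  rw [normA, Real.sqrt_le_one]

/-- Weighted Cauchy–Schwarz for `‖∑ X_k‖²`, with weights `1/r k` that sum to one and favour row `i`,
leaves `(n + 1)/2 ‖X_i‖²` below `‖X‖_A²`. This is where sharing between tasks gains the factor
`1/√n`. -/
theorem card_mul_norm_sq_le (X : MultiModel ι d) (i : ι) :
    (Fintype.card ι : ℝ) * ‖X i‖ ^ 2 ≤ 2 * normSqA X := by
  set n : ℝ := (Fintype.card ι : ℝ) with hn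
  have hn0 : 0 ≤ n := Nat.cast_nonneg _
  let r : ι → ℝ := fun k => if k = i then (n + 1) / 2 else n + 1
  have hr : ∀ k ∈ Finset.univ, 0 < r k := by
    intro k _
    simp only [r]
    split_ifs <;> linarith
  have h1 : ‖∑ k, X k‖ ^ 2 ≤ (∑ k, ‖X k‖) ^ 2 := by
    gcongr
    exact norm_sum_le _ _
  have h2 := Finset.sum_sq_le_sum_mul_sum_of_sq_le_mul Finset.univ (r := fun k => ‖X k‖)
    (f := fun k => (r k)⁻¹) (g := fun k => r k * ‖X k‖ ^ 2)
    (fun k hk => (inv_pos.2 (hr k hk)).le) (fun k hk => by have := hr k hk; positivity)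
    (fun k hk => le_of_eq (by have := hr k hk; field_simp))
  have e1 : ∑ k, (r k)⁻¹ = 1 := by
    have : ∀ k, (r k)⁻¹ = (n + 1)⁻¹ + if k = i then (n + 1)⁻¹ else 0 := by
      intro k
      simp only [r]
      split_ifs
      · field_simp; ring
      · simp
    simp only [this, Finset.sum_add_distrib, Finset.sum_const, Finset.card_univ, nsmul_eq_mul,
      Finset.sum_ite_eq', Finset.mem_univ, if_true, ← hn]
    field_simp
  have e2 : ∑ k, r k * ‖X k‖ ^ 2 = (n + 1) * ∑ k, ‖X k‖ ^ 2 - (n + 1) / 2 * ‖X i‖ ^ 2 := by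
    have : ∀ k, r k * ‖X k‖ ^ 2 =
        (n + 1) * ‖X k‖ ^ 2 - if k = i then (n + 1) / 2 * ‖X i‖ ^ 2 else 0 := by
      intro k
      simp only [r]
      split_ifs with h
      · subst h; ring
      · simp
    simp only [this, Finset.sum_sub_distrib, Finset.sum_ite_eq', Finset.mem_univ, if_true,
      Finset.mul_sum]
  rw [e1, e2, one_mul] at h2
  have h3 := normSqA_eq X
  rw [← hn] at h3
  nlinarith [sq_nonneg ‖X i‖]

theorem normSqA_smul (a : ℝ) (X : MultiModel ι d) : normSqA (a • X) = a ^ 2 * normSqA X := by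
  simp only [normSqA, Pi.smul_apply, inner_smul_left, inner_smul_right, Finset.mul_sum]
  refine Finset.sum_congr rfl fun i _ => Finset.sum_congr rfl fun i' _ => ?_
  simp
  ring

theorem normSqA_convexComb (s : ℝ) (X Y : MultiModel ι d) :
    normSqA (s • X + (1 - s) • Y) =
      s * normSqA X + (1 - s) * normSqA Y - s * (1 - s) * normSqA (X - Y) := by
  simp only [normSqA, Finset.mul_sum, ← Finset.sum_add_distrib, ← Finset.sum_sub_distrib]
  refine Finset.sum_congr rfl fun i _ => Finset.sum_congr rfl fun i' _ => ?_
  simp [inner_add_left, inner_add_right, inner_sub_left, inner_sub_right, inner_smul_left,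
    inner_smul_right]
  ring

theorem pairing_gradSum_cons (i : ι) (h : Model d) (H : History ι d) (V : MultiModel ι d) :
    pairing (gradSum ((i, h) :: H)) V = pairing (gradSum H) V + inner ℝ (V i) h := by
  simp only [pairing, gradSum, Pi.add_apply, inner_add_left, Finset.sum_add_distrib]
  congr 1
  rw [Finset.sum_eq_single i, Pi.single_eq_same, real_inner_comm]
  · intro k _ hk
    rw [Pi.single_eq_of_ne hk, inner_zero_left]
  · simp

/-- Optimality of the direction, with the slack given by strong convexity. -/
theorem IsDirection.add_half_normSqA_sub_le {b : ℝ} {H : History ι d} {X : MultiModel ι d}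
    (hX : IsDirection b H X) {V : MultiModel ι d} (hV : normA V ≤ 1) :
    ftrlObjective b H X + 1 / 2 * normSqA (V - X) ≤ ftrlObjective b H V := by
  obtain ⟨hX1, hmin⟩ := hX
  -- Compare `X` with the feasible point `sV + (1 - s)X` and divide by `s`; letting `s` tend to `0`
  -- then recovers the full slack.
  have key : ∀ s : ℝ, 0 < s → s < 1 →
      ftrlObjective b H X + 1 / 2 * (1 - s) * normSqA (V - X) ≤ ftrlObjective b H V := by
    intro s hs hs1
    have hid := normSqA_convexComb s V X
    have hmem : normA (s • V + (1 - s) • X) ≤ 1 := by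
      rw [normA_le_one_iff] at hV hX1 ⊢
      have := mul_nonneg (mul_nonneg hs.le (sub_nonneg.2 hs1.le)) (normSqA_nonneg (V - X))
      nlinarith
    have h := hmin (a := s • V + (1 - s) • X) hmem
    simp only [Set.mem_ofPred_eq, ftrlObjective, normA_sq, hid] at h ⊢
    have hlin : ∑ i, inner ℝ (gradSum H i) ((s • V + (1 - s) • X) i) =
        s * ∑ i, inner ℝ (gradSum H i) (V i) + (1 - s) * ∑ i, inner ℝ (gradSum H i) (X i) := by
      simp only [Finset.mul_sum, ← Finset.sum_add_distrib]
      refine Finset.sum_congr rfl fun i _ => ?_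
      simp [inner_add_right, inner_smul_right]
    rw [hlin] at h
    refine le_of_mul_le_mul_left ?_ hs
    linarith
  have hq := normSqA_nonneg (V - X)
  refine le_of_forall_pos_le_add fun ε hε => ?_
  have hs : 0 < min (1 / 2) (ε / (normSqA (V - X) + 1)) := by positivity
  have h := key _ hs (lt_of_le_of_lt (min_le_left _ _) (by norm_num))
  have h2 : min (1 / 2) (ε / (normSqA (V - X) + 1)) * normSqA (V - X) ≤ ε := by
    calc _ ≤ ε / (normSqA (V - X) + 1) * normSqA (V - X) := by
          gcongr
          exact min_le_right _ _
      _ ≤ ε := by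
          rw [div_mul_eq_mul_div, div_le_iff₀ (by linarith)]
          nlinarith
  nlinarith

/-- The cumulative linear loss of an algorithm on a history. -/
def cumLoss (alg : CliqueAlgorithm ι d) : History ι d → ℝ
  | [] => 0
  | (i, h) :: past => cumLoss alg past + inner ℝ (alg past i) h

theorem sqrt_add_inv_sqrt_le (m : ℝ) (hm : 0 ≤ m) :
    2 * Real.sqrt m + 1 / Real.sqrt (m + 1) ≤ 2 * Real.sqrt (m + 1) := by
  have h1 := Real.sq_sqrt hm
  have h2 := Real.sq_sqrt (by linarith : 0 ≤ m + 1)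
  have h3 : 0 < Real.sqrt (m + 1) := Real.sqrt_pos.2 (by linarith)
  rw [← le_sub_iff_add_le', div_le_iff₀ h3]
  nlinarith [sq_nonneg (Real.sqrt m - Real.sqrt (m + 1))]

/-- Regret of the directions against a fixed point of the unit ball. -/
theorem cumLoss_direction_le {L : ℝ} (hL : 0 < L) (H : History ι d) (hH : ∀ p ∈ H, ‖p.2‖ ≤ L) :
    ∀ V : MultiModel ι d, normA V ≤ 1 →
    cumLoss (fun H => direction (L * Real.sqrt (1 + (H.length : ℝ))) H) H ≤
      pairing (gradSum H) V
        + L * Real.sqrt H.length / Real.sqrt (Fintype.card ι) * (normSqA V / 2 + 2) := by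
  induction H with
  | nil => intro V _; simp [cumLoss, pairing, gradSum]
  | cons p H ih =>
    obtain ⟨i, h⟩ := p
    intro V hV
    have hh : ‖h‖ ≤ L := hH (i, h) (by simp)
    set m : ℝ := (H.length : ℝ) with hm
    have hm0 : 0 ≤ m := Nat.cast_nonneg _
    set X := direction (L * Real.sqrt (1 + m)) H with hXdef
    have hX := direction_spec (L * Real.sqrt (1 + m)) H
    rw [← hXdef] at hX
    -- The past is compared with the current direction rather than with `V`, which is why the
    -- induction quantifies over comparators.
    have hIH := ih (fun p hp => hH p (by simp [hp])) X hX.1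
    have hopt := hX.add_half_normSqA_sub_le hV
    have hn : (0 : ℝ) < Fintype.card ι := by
      exact_mod_cast Fintype.card_pos_iff.2 ⟨i⟩
    have hrow := card_mul_norm_sq_le (V - X) i
    set n : ℝ := (Fintype.card ι : ℝ) with hndef
    set sn := Real.sqrt n with hsn
    have hsn0 : 0 < sn := Real.sqrt_pos.2 hn
    have hsn2 : sn ^ 2 = n := Real.sq_sqrt hn.le
    set sm := Real.sqrt (1 + m) with hsm
    have hsm0 : 0 < sm := Real.sqrt_pos.2 (by linarith)
    set lam := L * sm / sn with hlam
    have hlam0 : 0 < lam := by positivity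
    have hopt' : pairing (gradSum H) X + lam * (normSqA X / 2) + lam / 2 * normSqA (V - X) ≤
        pairing (gradSum H) V + lam * (normSqA V / 2) := by
      have := mul_le_mul_of_nonneg_left hopt hlam0.le
      simp only [ftrlObjective, normA_sq, ← hndef, ← hsn] at this
      have e : lam * (sn / (L * sm)) = 1 := by rw [hlam]; field_simp
      unfold pairing
      linear_combination this + (∑ i, inner ℝ (gradSum H i) (V i)
        - ∑ i, inner ℝ (gradSum H i) (X i)) * e
    -- Young's inequality and the row bound: the strong-convexity slack pays for replacing `X` by
    -- `V` in this round, up to a term that telescopes into `√m`.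
    have hdual : inner ℝ (X i) h ≤
        inner ℝ (V i) h + lam / 2 * normSqA (V - X) + L / (sn * sm) := by
      have hcs : inner ℝ (X i) h - inner ℝ (V i) h ≤ ‖(V - X) i‖ * L := by
        rw [← inner_sub_left]
        calc inner ℝ (X i - V i) h ≤ ‖X i - V i‖ * ‖h‖ := real_inner_le_norm _ _
          _ ≤ ‖(V - X) i‖ * L := by
              rw [norm_sub_rev, Pi.sub_apply]
              gcongr
      have hyoung : ‖(V - X) i‖ * L ≤ lam / 4 * (n * ‖(V - X) i‖ ^ 2) + L / (sn * sm) := by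
        have e : lam / 4 * (n * ‖(V - X) i‖ ^ 2) + L / (sn * sm) - ‖(V - X) i‖ * L =
            L / (sn * sm) * (sn * sm * ‖(V - X) i‖ / 2 - 1) ^ 2 := by
          rw [hlam, ← hsn2]
          field_simp
          ring
        have : 0 ≤ L / (sn * sm) * (sn * sm * ‖(V - X) i‖ / 2 - 1) ^ 2 := by positivity
        linarith
      have := mul_le_mul_of_nonneg_left hrow hlam0.le
      linarith
    have hmono : Real.sqrt m ≤ sm := Real.sqrt_le_sqrt (by linarith)
    have hstep := sqrt_add_inv_sqrt_le m hm0
    rw [add_comm m 1, ← hsm] at hstep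
    have hX0 := normSqA_nonneg X
    have hA : L * Real.sqrt m / sn * (normSqA X / 2 + 2) + L / (sn * sm) ≤
        lam * (normSqA X / 2) + lam * 2 := by
      have h1 : L * Real.sqrt m / sn * (normSqA X / 2) ≤ lam * (normSqA X / 2) := by
        rw [hlam]
        gcongr
      have h2 := mul_le_mul_of_nonneg_left hstep (by positivity : 0 ≤ L / sn)
      have e : L / (sn * sm) = L / sn * (1 / sm) := by field_simp
      have e' : lam * 2 = L / sn * (2 * sm) := by rw [hlam]; ring
      rw [e, e']
      linear_combination h1 + h2
    rw [pairing_gradSum_cons]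
    simp only [cumLoss, List.length_cons, Nat.cast_add, Nat.cast_one]
    rw [← hm, ← hXdef, add_comm m 1, ← hsm, ← hlam]
    linarith

end Base

/-! ### Coin betting and the regret of the scaled algorithm. -/

section KT
variable {ι : Type} [Fintype ι] [DecidableEq ι] {d : ℕ}

/-- The row bound gives `√n ‖X_i‖ ≤ √2` on the unit ball, which explains the normalisation by `√2
L`. -/
theorem abs_ktSlope_le_one (β : ℕ → ℝ) {L : ℝ} (hL : 0 < L) (H : History ι d) (i : ι)
    {h : Model d} (hh : ‖h‖ ≤ L) : |ktSlope β L H i h| ≤ 1 := by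
  unfold ktSlope
  have hX := (normA_le_one_iff _).1 (direction_spec (β H.length) H).1
  set X := direction (β H.length) H
  have hrow := card_mul_norm_sq_le X i
  have h2 : Real.sqrt (Fintype.card ι) * ‖X i‖ ≤ Real.sqrt 2 := by
    refine Real.le_sqrt_of_sq_le ?_
    rw [mul_pow, Real.sq_sqrt (Nat.cast_nonneg _)]
    linarith
  have hs : 0 < Real.sqrt 2 := Real.sqrt_pos.2 (by norm_num)
  rw [abs_mul, abs_of_nonneg (by positivity), div_mul_eq_mul_div, div_le_one (by positivity)]
  calc Real.sqrt (Fintype.card ι) * |inner ℝ (X i) h|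
      ≤ Real.sqrt (Fintype.card ι) * (‖X i‖ * L) := by
        gcongr
        exact (abs_real_inner_le_norm _ _).trans (by gcongr)
    _ = Real.sqrt (Fintype.card ι) * ‖X i‖ * L := by ring
    _ ≤ _ := by gcongr

/-- The coins are `-u_s`, the wealth is `1 - ∑ z_s u_s`, and `z` bets the fraction of wealth for
which the potential grows no faster. The bound on the slope sum keeps the potential within its
domain. -/
theorem ktPotential_le_wealth (β : ℕ → ℝ) {L : ℝ} (hL : 0 < L) (H : History ι d)
    (hH : ∀ p ∈ H, ‖p.2‖ ≤ L) :
    |ktSlopeSum β L H| ≤ H.length ∧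
      ktPotential H.length (-ktSlopeSum β L H) ≤ 1 - ktLossSum β L H := by
  induction H with
  | nil => simp [ktSlopeSum, ktLossSum, ktPotential_zero]
  | cons p H ih =>
    obtain ⟨i, h⟩ := p
    obtain ⟨h1, h2⟩ := ih fun p hp => hH p (by simp [hp])
    have hc := abs_ktSlope_le_one β hL H i (hH (i, h) (by simp))
    simp only [ktSlopeSum, ktLossSum, List.length_cons]
    set S := ktSlopeSum β L H
    set c := ktSlope β L H i h
    refine ⟨?_, ?_⟩
    · push_cast
      exact (abs_add_le _ _).trans (by linarith)
    · have hstep := ktPotential_succ_le H.length (x := -S) (c := -c) (by rwa [abs_neg])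
        (by rwa [abs_neg])
      rw [neg_add]
      refine hstep.trans ?_
      have hm : (0 : ℝ) < H.length + 1 := by positivity
      have hfac : 0 ≤ 1 + -c * (-S / (H.length + 1)) := by
        have : |c * (S / (H.length + 1))| ≤ 1 := by
          rw [abs_mul]
          refine mul_le_one₀ hc (abs_nonneg _) ?_
          rw [abs_div, abs_of_pos hm, div_le_one hm]
          linarith
        have := (abs_le.1 this).1
        rw [neg_div, neg_mul_neg]
        linarith
      calc _ ≤ (1 - ktLossSum β L H) * (1 + -c * (-S / (H.length + 1))) := by gcongr
        _ = _ := by ring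

/-- Turns a wealth bound into a regret bound without computing a conjugate. Either `x` is below the
threshold, or the potential forces `W ≥ 1 + ρ m` and the left side is nonpositive; the logarithms
are chosen so that the threshold yields exactly this. -/
theorem one_add_mul_sub_le {m : ℕ} {x ρ W : ℝ} (hρ : 0 ≤ ρ) (hx : |x| ≤ m)
    (hW : ktPotential m x ≤ W) (hm : 1 ≤ m) :
    1 + ρ * x - W ≤
      1 + ρ * Real.sqrt (2 * m * (1 / 2 + Real.log (m + 1) + Real.log (1 + ρ * m))) := by
  obtain ⟨t, rfl⟩ := Nat.exists_eq_add_of_le' hm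
  set m : ℝ := ((t + 1 : ℕ) : ℝ) with hmdef
  have hm' : m = t + 1 := by rw [hmdef]; push_cast; ring
  have hm0 : 1 ≤ m := by rw [hm']; linarith [t.cast_nonneg (α := ℝ)]
  have hW0 : 0 < W := (ktPotential_pos (by linarith)).trans_le hW
  set Λ := 1 / 2 + Real.log (m + 1) + Real.log (1 + ρ * m)
  rcases le_or_gt x (Real.sqrt (2 * m * Λ)) with h | h
  · have := mul_le_mul_of_nonneg_left h hρ
    linarith
  have hx0 : 0 < x := (Real.sqrt_nonneg _).trans_lt h
  have hxm : x ≤ m := (le_abs_self x).trans hx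
  have hsq : Λ ≤ x ^ 2 / (2 * m) := by
    rw [le_div_iff₀ (by positivity), mul_comm]
    exact ((Real.sqrt_lt' hx0).1 h).le
  have hlow := (exp_le_ktPotential t (t + 1) x hx0.le hxm (by linarith)).trans hW
  have hρm : 0 ≤ ρ * m := by positivity
  have hbig : 1 + ρ * m ≤ W := by
    refine le_trans ?_ hlow
    rw [le_div_iff₀ (by linarith), ← hm', show (t : ℝ) + 2 = m + 1 by rw [hm']; ring]
    calc (1 + ρ * m) * (m + 1) = Real.exp (Real.log (m + 1) + Real.log (1 + ρ * m)) := by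
          rw [Real.exp_add, Real.exp_log (by linarith), Real.exp_log (by linarith)]
          ring
      _ ≤ _ := Real.exp_le_exp.2 (by simp only [Λ] at hsq; linarith)
  have h1 : ρ * x ≤ ρ * m := by gcongr
  have : 0 ≤ ρ * Real.sqrt (2 * m * Λ) := by positivity
  linarith

theorem ktSlopeSum_eq (β : ℕ → ℝ) (L : ℝ) (H : History ι d) :
    ktSlopeSum β L H = Real.sqrt (Fintype.card ι) / (Real.sqrt 2 * L) *
      cumLoss (fun H => direction (β H.length) H) H := by
  induction H with
  | nil => simp [ktSlopeSum, cumLoss]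
  | cons p H ih => simp only [ktSlopeSum, cumLoss, ih, ktSlope]; ring

theorem ktLossSum_eq (β : ℕ → ℝ) (L : ℝ) (H : History ι d) :
    ktLossSum β L H = Real.sqrt (Fintype.card ι) / (Real.sqrt 2 * L) *
      cumLoss (mtftrlKT β L) H := by
  induction H with
  | nil => simp [ktLossSum, cumLoss]
  | cons p H ih =>
    have h : inner ℝ (mtftrlKT β L H p.1) p.2 =
        ktMagnitude β L H * inner ℝ (direction (β H.length) H p.1) p.2 :=
      real_inner_smul_left _ _ _
    simp only [cumLoss, h, mul_add, ← ih, ktLossSum, ktMagnitude, ktSlope]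
    ring

theorem exists_eq_normA_smul (U : MultiModel ι d) : ∃ V, normA V ≤ 1 ∧ U = normA U • V := by
  rcases eq_or_ne (normA U) 0 with h | h
  · refine ⟨0, by simp [normA, normSqA], ?_⟩
    have hsq := normA_sq U
    rw [h] at hsq
    have hle := sum_norm_sq_le_normSqA U
    funext i
    have := Finset.single_le_sum (f := fun i => ‖U i‖ ^ 2) (fun _ _ => by positivity)
      (Finset.mem_univ i)
    have h0 : ‖U i‖ ^ 2 = 0 := le_antisymm (by linarith) (by positivity)
    simpa using h0
  · refine ⟨(normA U)⁻¹ • U, ?_, by rw [smul_smul, mul_inv_cancel₀ h, one_smul]⟩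
    rw [normA_le_one_iff, normSqA_smul, ← normA_sq, inv_pow, inv_mul_cancel₀ (pow_ne_zero 2 h)]

/-- Regret of `MT-FTRL` with the KT magnitude. -/
theorem cumLoss_mtftrlKT_sub_le {L : ℝ} (hL : 0 < L) {H : History ι d} (hne : H ≠ [])
    (hH : ∀ p ∈ H, ‖p.2‖ ≤ L) (U : MultiModel ι d) :
    cumLoss (mtftrlKT (fun n => L * Real.sqrt (1 + (n : ℝ))) L) H - pairing (gradSum H) U ≤
      L / Real.sqrt (Fintype.card ι) * (Real.sqrt 2 * (1 + normA U * Real.sqrt (2 * H.length *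
        (1 / 2 + Real.log (H.length + 1) + Real.log (1 + normA U * H.length))))
        + 5 / 2 * normA U * Real.sqrt H.length) := by
  obtain ⟨V, hV, hU⟩ := exists_eq_normA_smul U
  have hρ : 0 ≤ normA U := Real.sqrt_nonneg _
  have hdir := cumLoss_direction_le hL H hH V hV
  have hn : (0 : ℝ) < Fintype.card ι := by
    obtain ⟨p, H', rfl⟩ := List.exists_cons_of_ne_nil hne
    exact_mod_cast Fintype.card_pos_iff.2 ⟨p.1⟩
  set β : ℕ → ℝ := fun n => L * Real.sqrt (1 + (n : ℝ))
  obtain ⟨hw1, hw2⟩ := ktPotential_le_wealth β hL H hH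
  have hkt := one_add_mul_sub_le hρ (by rwa [abs_neg]) hw2 (List.length_pos_iff.2 hne)
  have hpair : pairing (gradSum H) U = normA U * pairing (gradSum H) V := by
    conv_lhs => rw [hU]
    exact pairing_smul_right _ _ _
  have e1 := ktSlopeSum_eq β L H
  have e2 := ktLossSum_eq β L H
  set ρ := normA U
  set m : ℝ := (H.length : ℝ)
  set Q := Real.sqrt (2 * m * (1 / 2 + Real.log (m + 1) + Real.log (1 + ρ * m)))
  set D := cumLoss (fun H => direction (L * Real.sqrt (1 + (H.length : ℝ))) H) H
  set A := cumLoss (mtftrlKT β L) H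
  set sn := Real.sqrt (Fintype.card ι : ℝ)
  have hsn : 0 < sn := Real.sqrt_pos.2 hn
  have hs2 : 0 < Real.sqrt 2 := Real.sqrt_pos.2 (by norm_num)
  rw [hpair]
  -- Regret of the magnitudes against the constant `ρ`, with the normalisation of the slopes undone.
  have hmag : A - ρ * D ≤ L / sn * (Real.sqrt 2 * (1 + ρ * Q)) := by
    have h : sn / (Real.sqrt 2 * L) * (A - ρ * D) ≤ 1 + ρ * Q := by
      rw [e1, e2] at hkt
      linear_combination hkt
    have := mul_le_mul_of_nonneg_left h (by positivity : 0 ≤ L / sn * Real.sqrt 2)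
    calc A - ρ * D = L / sn * Real.sqrt 2 * (sn / (Real.sqrt 2 * L) * (A - ρ * D)) := by
          field_simp
      _ ≤ _ := this
      _ = _ := by ring
  have hV2 : normSqA V ≤ 1 := (normA_le_one_iff V).1 hV
  have hD : D ≤ pairing (gradSum H) V + L * Real.sqrt m / sn * (5 / 2) := by
    refine hdir.trans ?_
    gcongr
    linarith
  have := mul_le_mul_of_nonneg_left hD hρ
  linear_combination hmag + this

end KT

/-- The bound `ρ ≤ √n s` cancels the prefactor `1/√n`, while `ρ ≤ 2n` serves only inside the
logarithm. The terms sum to `3/2 + 9/2 + 5/2`, which is below `10`. -/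
theorem local_regret_bound_le {n N m T L ρ s : ℝ} (hn : 1 ≤ n) (hnN : n ≤ N) (hm : 1 ≤ m)
    (hmT : m ≤ T) (hL1 : L ≤ 1) (hρ0 : 0 ≤ ρ) (hρ : ρ ≤ Real.sqrt n * s)
    (hρn : ρ ≤ 2 * n) (hs : 1 ≤ s) :
    L / Real.sqrt n * (Real.sqrt 2 * (1 + ρ * Real.sqrt (2 * m *
        (1 / 2 + Real.log (m + 1) + Real.log (1 + ρ * m)))) + 5 / 2 * ρ * Real.sqrt m) ≤
      10 * ((1 + Real.log N) * (1 + Real.log T)) * (s * Real.sqrt m) := by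
  have hsn : 1 ≤ Real.sqrt n := Real.one_le_sqrt.2 hn
  have hsm : 1 ≤ Real.sqrt m := Real.one_le_sqrt.2 hm
  have hlN : 0 ≤ Real.log N := Real.log_nonneg (by linarith)
  have hlT : 0 ≤ Real.log T := Real.log_nonneg (by linarith)
  set Q := (1 + Real.log N) * (1 + Real.log T) with hQ
  have hQ1 : 1 + Real.log N + Real.log T ≤ Q := by nlinarith [mul_nonneg hlN hlT]
  have hlog1 : Real.log (m + 1) ≤ 1 + Real.log T := by
    have h := Real.log_le_log (by linarith) (by linarith : m + 1 ≤ 2 * T)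
    rw [Real.log_mul (by norm_num) (by linarith)] at h
    linarith [Real.log_le_sub_one_of_pos (x := 2) (by norm_num)]
  have hlog2 : Real.log (1 + ρ * m) ≤ 2 + Real.log N + Real.log T := by
    have h1 : 1 + ρ * m ≤ 3 * (N * T) := by
      have a1 : ρ * m ≤ 2 * N * T := by
        apply mul_le_mul <;> linarith
      have a2 : 1 ≤ N * T := by nlinarith
      linarith
    have h := Real.log_le_log (by positivity) h1
    rw [Real.log_mul (by norm_num) (mul_ne_zero (by linarith) (by linarith)),
      Real.log_mul (by linarith) (by linarith)] at h
    linarith [Real.log_le_sub_one_of_pos (x := 3) (by norm_num)]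
  have hsqrt : Real.sqrt (2 * m * (1 / 2 + Real.log (m + 1) + Real.log (1 + ρ * m))) ≤
      Real.sqrt m * (3 * Q) := by
    rw [Real.sqrt_le_left (by positivity), mul_pow, Real.sq_sqrt (by linarith)]
    have : 2 * (1 / 2 + Real.log (m + 1) + Real.log (1 + ρ * m)) ≤ (3 * Q) ^ 2 := by nlinarith
    nlinarith
  set R := Real.sqrt (2 * m * (1 / 2 + Real.log (m + 1) + Real.log (1 + ρ * m)))
  have hs2 : Real.sqrt 2 ≤ 3 / 2 := Real.sqrt_le_iff.2 (by norm_num)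
  have hLn : L / Real.sqrt n ≤ 1 / Real.sqrt n := by gcongr
  have hsm0 : 1 ≤ s * Real.sqrt m := by nlinarith
  have hin : Real.sqrt 2 * (1 + ρ * R) + 5 / 2 * ρ * Real.sqrt m ≤
      Real.sqrt n * (10 * Q * (s * Real.sqrt m)) := by
    have a1 : ρ * R ≤ Real.sqrt n * s * (Real.sqrt m * (3 * Q)) := by gcongr
    have a2 : ρ * Real.sqrt m ≤ Real.sqrt n * s * Real.sqrt m := by gcongr
    have a3 : Real.sqrt 2 * (1 + ρ * R) ≤ 3 / 2 * (1 + ρ * R) := by gcongr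
    have hp : 1 ≤ Real.sqrt n * (s * Real.sqrt m) := by nlinarith
    have hpQ : Real.sqrt n * (s * Real.sqrt m) ≤ Real.sqrt n * (s * Real.sqrt m) * Q := by
      nlinarith
    linarith
  have hR : 0 ≤ Real.sqrt 2 * (1 + ρ * R) + 5 / 2 * ρ * Real.sqrt m := by positivity
  calc _ ≤ 1 / Real.sqrt n * (Real.sqrt n * (10 * Q * (s * Real.sqrt m))) := by gcongr
    _ = _ := by field_simp

/-! ### From the `A`-norm of the comparator to the local task variance. -/

section Cool

variable {N : ℕ} (G : SimpleGraph (Fin N)) [DecidableRel G.Adj] {d : ℕ}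

theorem one_le_card_nbhd (j : Fin N) : 1 ≤ (nbhd G j).card :=
  Finset.card_pos.2 ⟨j, mem_nbhd_self G j⟩

theorem localVariance_mul (U : MultiModel (Fin N) d) (j : Fin N) :
    localVariance G U j * (((nbhd G j).card : ℝ) - 1) =
      1 / (2 * ((nbhd G j).card : ℝ)) * ∑ i ∈ nbhd G j, ∑ i' ∈ nbhd G j, ‖U i - U i'‖ ^ 2 := by
  have h1 := one_le_card_nbhd G j
  unfold localVariance
  -- For a single agent the factor `N_j - 1` cannot be cancelled, but the pairwise sum vanishes.
  rcases eq_or_ne (nbhd G j).card 1 with h | h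
  · obtain ⟨a, ha⟩ := Finset.card_eq_one.1 h
    simp [ha]
  · have h2 : ((nbhd G j).card : ℝ) - 1 ≠ 0 := by
      rw [sub_ne_zero]
      exact_mod_cast h
    have h3 : ((nbhd G j).card : ℝ) ≠ 0 := by
      have : (nbhd G j).card ≠ 0 := by omega
      exact_mod_cast this
    field_simp

/-- `A` is the identity plus the Laplacian of the complete graph, whose quadratic form sums the
squared pairwise distances. -/
theorem normSqA_eq_variance {ι : Type} [Fintype ι] [DecidableEq ι] (X : MultiModel ι d) :
    normSqA X = ∑ i, ‖X i‖ ^ 2 + 1 / 2 * ∑ i, ∑ i', ‖X i - X i'‖ ^ 2 := by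
  have h : ‖∑ i, X i‖ ^ 2 = ∑ i, ∑ i', inner ℝ (X i) (X i') := by
    rw [← real_inner_self_eq_norm_sq, sum_inner]
    simp_rw [inner_sum]
  have e : ∀ i i', ‖X i - X i'‖ ^ 2 = ‖X i‖ ^ 2 + ‖X i'‖ ^ 2 - 2 * inner ℝ (X i) (X i') := by
    intro i i'
    rw [norm_sub_sq_real]
    ring
  rw [normSqA_eq, h]
  simp only [e, Finset.sum_sub_distrib, Finset.sum_add_distrib, Finset.sum_const,
    Finset.card_univ, nsmul_eq_mul, ← Finset.mul_sum]
  ring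

theorem normSqA_restrict_le {U : MultiModel (Fin N) d} (hU : ∀ i, ‖U i‖ ≤ 1) (j : Fin N) :
    normSqA (fun i : nbhd G j => U i) ≤ (nbhd G j).card *
      (1 + localVariance G U j * (((nbhd G j).card : ℝ) - 1)) := by
  have h1 : (0 : ℝ) < (nbhd G j).card := by exact_mod_cast one_le_card_nbhd G j
  rw [localVariance_mul, normSqA_eq_variance]
  have hs : ∑ i : nbhd G j, ‖U i‖ ^ 2 ≤ (nbhd G j).card := by
    calc _ ≤ ∑ _i : nbhd G j, (1 : ℝ) :=
          Finset.sum_le_sum fun i _ => pow_le_one₀ (norm_nonneg _) (hU i)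
      _ = _ := by simp
  have e : ∑ i : nbhd G j, ∑ i' : nbhd G j, ‖U i - U i'‖ ^ 2 =
      ∑ i ∈ nbhd G j, ∑ i' ∈ nbhd G j, ‖U i - U i'‖ ^ 2 := by
    rw [← Finset.sum_coe_sort (nbhd G j)]
    refine Finset.sum_congr rfl fun i _ => ?_
    exact Finset.sum_coe_sort (nbhd G j) fun i' => ‖U i - U i'‖ ^ 2
  rw [e]
  have : ((nbhd G j).card : ℝ) * (1 + 1 / (2 * ((nbhd G j).card : ℝ)) *
      ∑ i ∈ nbhd G j, ∑ i' ∈ nbhd G j, ‖U i - U i'‖ ^ 2) =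
      (nbhd G j).card + 1 / 2 * ∑ i ∈ nbhd G j, ∑ i' ∈ nbhd G j, ‖U i - U i'‖ ^ 2 := by
    field_simp
  rw [this]
  linarith

theorem normA_restrict_le {U : MultiModel (Fin N) d} (hU : ∀ i, ‖U i‖ ≤ 1) (j : Fin N) :
    normA (fun i : nbhd G j => U i) ≤ 2 * (nbhd G j).card := by
  have h1 : (1 : ℝ) ≤ (nbhd G j).card := by exact_mod_cast one_le_card_nbhd G j
  refine Real.sqrt_le_iff.2 ⟨by positivity, ?_⟩
  rw [normSqA_eq, Fintype.card_coe]
  have hs : ∑ i : nbhd G j, ‖U i‖ ^ 2 ≤ (nbhd G j).card := by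
    calc _ ≤ ∑ _i : nbhd G j, (1 : ℝ) :=
          Finset.sum_le_sum fun i _ => pow_le_one₀ (norm_nonneg _) (hU i)
      _ = _ := by simp
  have := sq_nonneg ‖∑ i : nbhd G j, U i‖
  nlinarith

/-! ### Local histories and the splitting of the global regret. -/

variable (w : Fin N → Fin N → ℝ) (act : ℕ → Fin N) (g : ℕ → Model d)

theorem length_localHistory (j : Fin N) (T : ℕ) :
    (localHistory G w act g j T).length = ∑ i ∈ nbhd G j, activations act T i := by
  induction T with
  | zero => simp [localHistory, activations]
  | succ T ih =>
    have h : ∀ i, activations act (T + 1) i = activations act T i + if act T = i then 1 else 0 := by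
      intro i
      unfold activations
      rw [Finset.range_add_one, Finset.filter_insert]
      split_ifs <;> simp
    simp only [h, Finset.sum_add_distrib, ← ih, Finset.sum_ite_eq, localHistory]
    split_ifs <;> simp

theorem length_localHistory_le (j : Fin N) (T : ℕ) :
    (localHistory G w act g j T).length ≤ T := by
  induction T with
  | zero => simp [localHistory]
  | succ T ih =>
    simp only [localHistory]
    split_ifs
    · simpa using ih
    · omega

variable {w g}

theorem norm_le_of_mem_localHistory (hw : ∀ i, ∀ j ∈ nbhd G i, 0 ≤ w i j)
    (hg : ∀ t, ‖g t‖ ≤ 1) (j : Fin N) (T : ℕ) :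
    ∀ p ∈ localHistory G w act g j T, ‖p.2‖ ≤ maxWeight G w j := by
  induction T with
  | zero => simp [localHistory]
  | succ T ih =>
    simp only [localHistory]
    split_ifs with h
    · intro p hp
      rcases List.mem_cons.1 hp with rfl | hp
      · have h0 := hw _ j (mem_nbhd_symm G h)
        simp only [norm_smul, Real.norm_of_nonneg h0]
        calc w (act T) j * ‖g T‖ ≤ w (act T) j * 1 := by
              gcongr
              exact hg T
          _ = w (act T) j := mul_one _
          _ ≤ _ := Finset.le_sup' (fun i => w i j) h
      · exact ih p hp
    · exact ih

theorem maxWeight_le_one (hw : ∀ i, ∀ j ∈ nbhd G i, 0 ≤ w i j)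
    (hw1 : ∀ i, ∑ j ∈ nbhd G i, w i j = 1) (j : Fin N) : maxWeight G w j ≤ 1 := by
  refine Finset.sup'_le _ _ fun i hi => ?_
  rw [← hw1 i]
  exact Finset.single_le_sum (hw i) (mem_nbhd_symm G hi)

/-- The contribution of agent `j` to the linearised regret of round `t`. -/
def localTerm (base : (j : Fin N) → CliqueAlgorithm (nbhd G j) d) (w : Fin N → Fin N → ℝ)
    (act : ℕ → Fin N) (g : ℕ → Model d) (U : MultiModel (Fin N) d) (j : Fin N) (t : ℕ) : ℝ :=
  if h : act t ∈ nbhd G j then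
    inner ℝ (base j (localHistory G w act g j t) ⟨act t, h⟩ - U (act t)) (w (act t) j • g t)
  else 0

theorem sum_localTerm (base : (j : Fin N) → CliqueAlgorithm (nbhd G j) d)
    (U : MultiModel (Fin N) d) (j : Fin N) (T : ℕ) :
    ∑ t ∈ Finset.range T, localTerm G base w act g U j t =
      cumLoss (base j) (localHistory G w act g j T) -
        pairing (gradSum (localHistory G w act g j T)) (fun i : nbhd G j => U i) := by
  induction T with
  | zero => simp [localHistory, cumLoss, gradSum, pairing]
  | succ T ih =>
    rw [Finset.sum_range_succ, ih]
    simp only [localHistory, localTerm]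
    split_ifs with h
    · rw [pairing_gradSum_cons, cumLoss, inner_sub_left]
      ring
    · ring

/-- The weights sum to one, so `U_{i_t}` is split with the same weights as the prediction. Symmetry
of neighbourhoods lets the sum run over all agents, the others contributing zero. -/
theorem inner_coolPrediction_sub (base : (j : Fin N) → CliqueAlgorithm (nbhd G j) d)
    (hw1 : ∀ i, ∑ j ∈ nbhd G i, w i j = 1) (U : MultiModel (Fin N) d) (t : ℕ) :
    inner ℝ (g t) (coolPrediction G base w act g t - U (act t)) =
      ∑ j, localTerm G base w act g U j t := by
  have hU : U (act t) = ∑ j : nbhd G (act t), w (act t) j • U (act t) := by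
    rw [Finset.sum_coe_sort (nbhd G (act t)) (fun j => w (act t) j • U (act t)),
      ← Finset.sum_smul, hw1, one_smul]
  have hsub : ∑ j ∈ nbhd G (act t), localTerm G base w act g U j t =
      ∑ j, localTerm G base w act g U j t := by
    refine Finset.sum_subset (Finset.subset_univ _) fun j _ hj => ?_
    rw [localTerm, dif_neg fun h => hj (mem_nbhd_symm G h)]
  rw [← hsub, ← Finset.sum_coe_sort]
  conv_lhs => rw [hU]
  rw [coolPrediction, ← Finset.sum_sub_distrib, inner_sum]
  refine Finset.sum_congr rfl fun j _ => ?_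
  rw [localTerm, dif_pos (mem_nbhd_symm G j.2), ← smul_sub, real_inner_smul_right,
    real_inner_smul_right, real_inner_comm]

theorem regret_le_sum_localTerm {ℓ : ℕ → Model d → ℝ} (hw1 : ∀ i, ∑ j ∈ nbhd G i, w i j = 1)
    (hsub : ∀ t, IsSubgradient (ℓ t) (coolKT G w act g t) (g t)) (U : MultiModel (Fin N) d)
    (T : ℕ) :
    regret ℓ act (coolKT G w act g) U T ≤
      ∑ j, ∑ t ∈ Finset.range T, localTerm G (baseKT G w) w act g U j t := by
  rw [Finset.sum_comm]
  refine Finset.sum_le_sum fun t _ => ?_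
  rw [← inner_coolPrediction_sub G act (baseKT G w) hw1 U t]
  have h := hsub t (U (act t))
  rw [← neg_sub (coolKT G w act g t), inner_neg_right] at h
  unfold coolKT at h ⊢
  linarith

theorem sum_localTerm_baseKT_le (hw : ∀ i, ∀ j ∈ nbhd G i, 0 ≤ w i j)
    (hw1 : ∀ i, ∑ j ∈ nbhd G i, w i j = 1) (hg : ∀ t, ‖g t‖ ≤ 1) {U : MultiModel (Fin N) d}
    (hU : ∀ i, ‖U i‖ ≤ 1) (j : Fin N) (T : ℕ) :
    ∑ t ∈ Finset.range T, localTerm G (baseKT G w) w act g U j t ≤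
      10 * ((1 + Real.log N) * (1 + Real.log T)) *
        (Real.sqrt (1 + localVariance G U j * (((nbhd G j).card : ℝ) - 1)) *
          Real.sqrt (∑ i ∈ nbhd G j, (activations act T i : ℝ))) := by
  have hlen : ∑ i ∈ nbhd G j, (activations act T i : ℝ) =
      ((localHistory G w act g j T).length : ℝ) := by
    rw [length_localHistory]
    push_cast
    rfl
  have hlogs : 0 ≤ (1 + Real.log N) * (1 + Real.log T) :=
    mul_nonneg (by linarith [Real.log_natCast_nonneg N]) (by linarith [Real.log_natCast_nonneg T])
  have hL0 : 0 ≤ maxWeight G w j :=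
    (hw j j (mem_nbhd_self G j)).trans (Finset.le_sup' (fun i => w i j) (mem_nbhd_self G j))
  -- If the maximal weight is zero, every gradient fed to agent `j` vanishes, whatever it outputs.
  rcases hL0.eq_or_lt with hL | hL
  · have hz : ∀ t, localTerm G (baseKT G w) w act g U j t = 0 := by
      intro t
      rw [localTerm]
      split_ifs with h
      · have h1 : w (act t) j ≤ maxWeight G w j := Finset.le_sup' (fun i => w i j) h
        have h2 := hw _ j (mem_nbhd_symm G h)
        rw [le_antisymm (h1.trans hL.symm.le) h2, zero_smul, inner_zero_right]
      · rfl
    simp only [hz, Finset.sum_const_zero]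
    positivity
  rw [sum_localTerm, hlen]
  -- An agent with no local round contributes zero on both sides. Otherwise `m ≥ 1` absorbs the
  -- additive constant of coin betting.
  rcases eq_or_ne (localHistory G w act g j T) [] with hne | hne
  · rw [hne]
    simp [cumLoss, gradSum, pairing]
  have hm : 1 ≤ (localHistory G w act g j T).length := List.length_pos_iff.2 hne
  have hreg := cumLoss_mtftrlKT_sub_le hL hne (norm_le_of_mem_localHistory G act hw hg j T)
    (fun i : nbhd G j => U i)
  refine hreg.trans ?_
  rw [Fintype.card_coe]
  have hvar : 0 ≤ localVariance G U j * (((nbhd G j).card : ℝ) - 1) := by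
    rw [localVariance_mul]
    positivity
  refine local_regret_bound_le (by exact_mod_cast one_le_card_nbhd G j) ?_
    (by exact_mod_cast hm) (by exact_mod_cast length_localHistory_le G w act g j T)
    (maxWeight_le_one G hw hw1 j) (Real.sqrt_nonneg _) ?_ (normA_restrict_le G hU j)
    (Real.one_le_sqrt.2 (by linarith))
  · have := Finset.card_le_univ (nbhd G j)
    rw [Fintype.card_fin] at this
    exact_mod_cast this
  · rw [← Real.sqrt_mul (Nat.cast_nonneg _)]
    exact Real.sqrt_le_sqrt (normSqA_restrict_le G hU j)

end Cool

end MTCool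

end

theorem mainTheorem8 :
    ∃ C : ℝ, 0 < C ∧ ∃ k : ℕ,
      ∀ (N d : ℕ) (G : SimpleGraph (Fin N)) [DecidableRel G.Adj]
        (w : Fin N → Fin N → ℝ)
        (_ : ∀ i, ∀ j ∈ MTCool.nbhd G i, 0 ≤ w i j)
        (_ : ∀ i, ∑ j ∈ MTCool.nbhd G i, w i j = 1)
        (act : ℕ → Fin N)
        (ℓ : ℕ → MTCool.Model d → ℝ)
        (_ : ∀ t, ConvexOn ℝ Set.univ (ℓ t))
        (g : ℕ → MTCool.Model d)
        (_ : ∀ t, MTCool.IsSubgradient (ℓ t) (MTCool.coolKT G w act g t) (g t))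
        (_ : ∀ t, ‖g t‖ ≤ 1)
        (T : ℕ)
        (U : MTCool.MultiModel (Fin N) d)
        (_ : ∀ i, ‖U i‖ ≤ 1),
        MTCool.regret ℓ act (MTCool.coolKT G w act g) U T ≤
          C * ((1 + Real.log N) * (1 + Real.log T)) ^ k *
            ∑ j : Fin N,
              Real.sqrt (1 + MTCool.localVariance G U j * (((MTCool.nbhd G j).card : ℝ) - 1)) *
                Real.sqrt (∑ i ∈ MTCool.nbhd G j, (MTCool.activations act T i : ℝ)) := by
  refine ⟨10, by norm_num, 1, ?_⟩
  intro N d G _ w hw hw1 act ℓ _ g hsub hg T U hU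
  rw [pow_one, Finset.mul_sum]
  exact (MTCool.regret_le_sum_localTerm G act hw1 hsub U T).trans
    (Finset.sum_le_sum fun j _ => MTCool.sum_localTerm_baseKT_le G act hw hw1 hg hU j T)
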